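/- Let $Q\ge 2$ be an even integer and let $f:\mathbb Z\to\{-1,1\}$ be $Q$-periodic with $\sum_{y=1}^{Q} f(y)=0$. Let $\lambda=(\lambda_y)_{y\in\mathbb Z}$ be a deterministic $\{0,1\}$-valued sequence with $\|\lambda\|:=\operatorname{card}\{y\in\mathbb Z:\lambda_y=1\}<\infty$, let $\rho=(\rho_y)_{y\in\mathbb Z}$ be any $\{-1,1\}$-valued sequence (in particular, any realisation of a sequence of independent uniform random signs), and put $\varepsilon_y=(1-\lambda_y)f(y)+\lambda_y\rho_y\in\{-1,1\}$. Consider the partially directed lattice $\mathbb Z^2_\varepsilon$ with vertex set $\mathbb Z^2$ in which $(u,v)$ is a (directed) allowed edge if and only if either $v_1=u_1$ and $v_2=u_2\pm1$, or $v_2=u_2$ and $v_1=u_1+\varepsilon_{u_2}$. Then the simple random walk on $\mathbb Z^2_\varepsilon$, i.e. the Markov chain $(M_n)_{n\ge0}$ on $\mathbb Z^2$ with transition probabilities $P(u,v)=\frac13$ if $(u,v)$ is an allowed edge and $P(u,v)=0$ otherwise, is recurrent: for every $u\in\mathbb Z^2$, the walk started at $M_0=u$ satisfies, almost surely, $M_n=u$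 for infinitely many $n$. -/

import Mathlib

open MeasureTheory Filter

namespace PartiallyDirectedLattice

/-- The directed edges of the partially directed lattice on `ℤ × ℤ` with horizontal orientations
`ε`: every vertical edge can be traversed both ways, while on the horizontal line of ordinate `y`
one can only move by `ε y`. -/
def AllowedEdge (ε : ℤ → ℤ) (u v : ℤ × ℤ) : Prop :=
  (v.1 = u.1 ∧ (v.2 = u.2 + 1 ∨ v.2 = u.2 - 1)) ∨ (v.2 = u.2 ∧ v.1 = u.1 + ε u.2)

open Classical in
/-- The transition matrix of the simple random walk on the lattice with orientations `ε`. -/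
noncomputable def transition (ε : ℤ → ℤ) (u v : ℤ × ℤ) : ℝ :=
  if AllowedEdge ε u v then 1 / 3 else 0

/-- The orientations obtained from `f` by replacing `f y` by `ρ y` at the defects, i.e. at the
levels `y` with `lam y = 1`. -/
def orientation (f lam ρ : ℤ → ℤ) (y : ℤ) : ℤ :=
  (1 - lam y) * f y + lam y * ρ y

/-- `M` is, under `μ`, a time-homogeneous Markov chain on the countable state space `S`, with
transition matrix `P` and initial state `u`. The Markov property
`μ (M (n+1) = x (n+1) | M 0 = x 0, …, M n = x n) = P (x n) (x (n+1))` is written in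
multiplicative form, so that it says nothing about conditioning events of probability zero. -/
structure IsMarkovChain {S Ω : Type*} [MeasurableSpace S] [MeasurableSpace Ω] (P : S → S → ℝ)
    (u : S) (μ : Measure Ω) (M : ℕ → Ω → S) : Prop where
  measurable : ∀ n, Measurable (M n)
  start : ∀ᵐ ω ∂μ, M 0 ω = u
  step : ∀ (n : ℕ) (x : ℕ → S),
    μ.real {ω | ∀ i ≤ n + 1, M i ω = x i} =
      μ.real {ω | ∀ i ≤ n, M i ω = x i} * P (x n) (x (n + 1))

end PartiallyDirectedLattice

namespace PartiallyDirectedLattice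

/-! ### Finitely supported sums on the lattice -/

open Function

/-! The walk is not reversible, but its drift is the increment of a bounded sequence. Indeed `ε = f
+ lam * (ρ - f)`, where `f` is periodic with zero mean and the correction is finitely supported, so
`ε y = s (y + 1) - s y` with `s` bounded. Summation by parts then puts a difference on both
arguments of the antisymmetric part of the form `⟨(1 - P*) g, h⟩`, which gives the sector condition
`form_le_dirichlet_add`: the form is controlled by the Dirichlet energies of `g` and `h`, as in the
reversible case.

Suppose the expected number `G` of visits to `u` is finite. The truncated Green functions `g_T =
occupation ε u T` have energy at most a multiple of `G` (`dirichlet_occupation_le`). Tested against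
`h` with `h u = 1`, the form at `g_T` tends to `1`, while the sector condition makes it small once
`h` has small energy. Such `h` exist because points of the planar lattice have zero capacity
(`exists_dirichlet_lt`). Hence the Green function diverges (`not_summable_walkLaw`), and a
last-visit decomposition turns this into infinitely many returns almost surely. -/

lemma hasFiniteSupport_shift {g : ℤ × ℤ → ℝ} (hg : g.HasFiniteSupport) (a b : ℤ) :
    (fun v : ℤ × ℤ => g (v.1 + a, v.2 + b)).HasFiniteSupport :=
  Set.Finite.preimage (f := fun v : ℤ × ℤ => (v.1 + a, v.2 + b))
    (fun v _ w _ h => by simpa [Prod.ext_iff] using h) hg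

lemma tsum_shift (g : ℤ × ℤ → ℝ) (a b : ℤ) :
    ∑' v : ℤ × ℤ, g (v.1 + a, v.2 + b) = ∑' v, g v :=
  (Equiv.addRight ((a, b) : ℤ × ℤ)).tsum_eq g

lemma tsum_shift_sub {g : ℤ × ℤ → ℝ} (hg : g.HasFiniteSupport) (a b : ℤ) :
    ∑' v : ℤ × ℤ, (g (v.1 + a, v.2 + b) - g v) = 0 := by
  rw [Summable.tsum_sub (summable_of_hasFiniteSupport (hasFiniteSupport_shift hg a b))
    (summable_of_hasFiniteSupport hg), tsum_shift, sub_self]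

/-! ### Dirichlet form, summation by parts and the sector condition -/

/-- The discrete Dirichlet integral on `ℤ × ℤ`. -/
noncomputable def dirichlet (g : ℤ × ℤ → ℝ) : ℝ :=
  ∑' v : ℤ × ℤ, ((g (v.1 + 1, v.2) - g v) ^ 2 + (g (v.1, v.2 + 1) - g v) ^ 2)

/-- The action on row vectors of the transition matrix of the lattice with orientations `ε`. -/
noncomputable def adjointStep (ε : ℤ → ℤ) (g : ℤ × ℤ → ℝ) (v : ℤ × ℤ) : ℝ :=
  (g (v.1, v.2 + 1) + g (v.1, v.2 - 1) + g (v.1 - ε v.2, v.2)) / 3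

lemma hasFiniteSupport_mul_left {f : ℤ × ℤ → ℝ} (hf : f.HasFiniteSupport) (g : ℤ × ℤ → ℝ) :
    (fun v => f v * g v).HasFiniteSupport :=
  hf.mul_left g

lemma hasFiniteSupport_mul_right (f : ℤ × ℤ → ℝ) {g : ℤ × ℤ → ℝ} (hg : g.HasFiniteSupport) :
    (fun v => f v * g v).HasFiniteSupport :=
  hg.mul_right f

-- One finitely supported factor suffices: coefficients such as `s` and `ε` are supported
-- everywhere.
attribute [fun_prop] hasFiniteSupport_mul_left hasFiniteSupport_mul_right

lemma tsum_shift_fst_sub {g : ℤ × ℤ → ℝ} (hg : g.HasFiniteSupport) :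
    ∑' v : ℤ × ℤ, (g (v.1 + 1, v.2) - g v) = 0 := by
  simpa using tsum_shift_sub hg 1 0

lemma tsum_shift_snd_sub {g : ℤ × ℤ → ℝ} (hg : g.HasFiniteSupport) :
    ∑' v : ℤ × ℤ, (g (v.1, v.2 + 1) - g v) = 0 := by
  simpa using tsum_shift_sub hg 0 1

/-- Two finitely supported functions that differ by a discrete divergence have the same sum. -/
lemma tsum_eq_of_sub_eq_divergence {F G A B : ℤ × ℤ → ℝ} (hG : G.HasFiniteSupport)
    (hA : A.HasFiniteSupport) (hB : B.HasFiniteSupport)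
    (h : ∀ v, F v = G v + ((A (v.1 + 1, v.2) - A v) + (B (v.1, v.2 + 1) - B v))) :
    ∑' v, F v = ∑' v, G v := by
  have hA' : (fun v : ℤ × ℤ => A (v.1 + 1, v.2) - A v).HasFiniteSupport := by
    fun_prop (disch := first | (intro a b h; simpa [Prod.ext_iff] using h) | simp)
  have hB' : (fun v : ℤ × ℤ => B (v.1, v.2 + 1) - B v).HasFiniteSupport := by
    fun_prop (disch := first | (intro a b h; simpa [Prod.ext_iff] using h) | simp)
  simp_rw [h]
  rw [Summable.tsum_add (summable_of_hasFiniteSupport hG)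
      (summable_of_hasFiniteSupport (hA'.fun_add hB')),
    Summable.tsum_add (summable_of_hasFiniteSupport hA') (summable_of_hasFiniteSupport hB'),
    tsum_shift_fst_sub hA, tsum_shift_snd_sub hB, add_zero, add_zero]

/-- Summation by parts: if the orientations are the increments of `s`, the bilinear form of the
walk is a symmetric Dirichlet form plus a first order antisymmetric term with coefficient `s`. -/
lemma six_mul_form_eq {ε : ℤ → ℤ} (hε : ∀ y, ε y = 1 ∨ ε y = -1) {s : ℤ → ℝ}
    (hs : ∀ y, s (y + 1) = s y + ε y) (g : ℤ × ℤ → ℝ) {h : ℤ × ℤ → ℝ}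
    (hh : h.HasFiniteSupport) :
    6 * ∑' v, (g v - adjointStep ε g v) * h v =
      ∑' v : ℤ × ℤ, (2 * ((g (v.1, v.2 + 1) - g v) * (h (v.1, v.2 + 1) - h v)) +
        (g (v.1 + 1, v.2) - g v) * (h (v.1 + 1, v.2) - h v) +
        s (v.2 + 1) * ((g (v.1, v.2 + 1) - g v) * (h (v.1 + 1, v.2 + 1) - h (v.1 - 1, v.2 + 1)) -
          (g (v.1 + 1, v.2) - g (v.1 - 1, v.2)) * (h (v.1, v.2 + 1) - h v))) := by
  rw [← tsum_mul_left]
  -- The horizontal part is `2 * (g - g(x - ε)) = (2g - g(x+1) - g(x-1)) + ε * (g(x+1) - g(x-1))`.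
  -- With `ε = s (y+1) - s y`, the `s`-term of `B` performs Abel summation in `y`; that of `A` then
  -- moves a centred difference in `x` from `g` to `h`.
  refine tsum_eq_of_sub_eq_divergence
    (A := fun v => -((g v - g (v.1 - 1, v.2)) * h v) -
      s (v.2 + 1) * ((g (v.1, v.2 + 1) - g v) * h (v.1 - 1, v.2 + 1) +
        (g (v.1 - 1, v.2 + 1) - g (v.1 - 1, v.2)) * h (v.1, v.2 + 1)))
    (B := fun v => -2 * ((g v - g (v.1, v.2 - 1)) * h v) +
      s v.2 * ((g (v.1 + 1, v.2) - g (v.1 - 1, v.2)) * h v)) ?_ ?_ ?_ ?_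
  · fun_prop (disch := first | (intro a b h; simpa [Prod.ext_iff] using h) | simp)
  · fun_prop (disch := first | (intro a b h; simpa [Prod.ext_iff] using h) | simp)
  · fun_prop (disch := first | (intro a b h; simpa [Prod.ext_iff] using h) | simp)
  · rintro ⟨x, y⟩
    have h1 := hs y
    simp only [adjointStep, add_sub_cancel_right, h1]
    rcases hε y with h2 | h2 <;> simp only [h2, sub_neg_eq_add] <;> push_cast <;> ring

/-- On the diagonal the drift drops out: `2 * (g - g') * g = (g - g') ^ 2 + (g ^ 2 - g' ^ 2)`, and
the last bracket telescopes along each row whatever its orientation. -/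
lemma dirichlet_le_form {ε : ℤ → ℤ} (hε : ∀ y, ε y = 1 ∨ ε y = -1) {g : ℤ × ℤ → ℝ}
    (hg : g.HasFiniteSupport) :
    dirichlet g ≤ 6 * ∑' v, (g v - adjointStep ε g v) * g v := by
  have key : 6 * ∑' v, (g v - adjointStep ε g v) * g v =
      ∑' v : ℤ × ℤ, (2 * (g (v.1, v.2 + 1) - g v) ^ 2 + (g (v.1 + 1, v.2) - g v) ^ 2) := by
    rw [← tsum_mul_left]
    refine tsum_eq_of_sub_eq_divergence
      (A := fun v => -((g v - g (v.1 - 1, v.2)) * g v) + ε v.2 * (g v * g (v.1 - 1, v.2)))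
      (B := fun v => -2 * ((g v - g (v.1, v.2 - 1)) * g v)) ?_ ?_ ?_ ?_
    · simp only [sq]
      fun_prop (disch := first | (intro a b h; simpa [Prod.ext_iff] using h) | simp)
    · fun_prop (disch := first | (intro a b h; simpa [Prod.ext_iff] using h) | simp)
    · fun_prop (disch := first | (intro a b h; simpa [Prod.ext_iff] using h) | simp)
    · rintro ⟨x, y⟩
      simp only [adjointStep, add_sub_cancel_right]
      rcases hε y with h2 | h2 <;> simp only [h2, sub_neg_eq_add] <;> push_cast <;> ring
  rw [key]
  refine Summable.tsum_le_tsum (fun v => ?_) (summable_of_hasFiniteSupport ?_)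
    (summable_of_hasFiniteSupport ?_)
  · nlinarith [sq_nonneg (g (v.1, v.2 + 1) - g v)]
  · simp only [sq]
    fun_prop (disch := first | (intro a b h; simpa [Prod.ext_iff] using h) | simp)
  · simp only [sq]
    fun_prop (disch := first | (intro a b h; simpa [Prod.ext_iff] using h) | simp)

lemma two_mul_mul_le_add_div {t : ℝ} (ht : 0 < t) (a b : ℝ) :
    2 * (a * b) ≤ t * a ^ 2 + b ^ 2 / t := by
  have h := mul_nonneg ht.le (sq_nonneg (a - b / t))
  have : t * (a - b / t) ^ 2 = t * a ^ 2 + b ^ 2 / t - 2 * (a * b) := by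
    field_simp
    ring
  linarith

/-- A centred difference is a sum of two edge increments, so its square costs a factor `4` after
summation. The shift `b` covers both arguments of the antisymmetric term: `0` for `g`, `1` for `h`.
-/
lemma tsum_sq_sub_le_dirichlet {g : ℤ × ℤ → ℝ} (hg : g.HasFiniteSupport) (b : ℤ) :
    ∑' v : ℤ × ℤ, ((g (v.1, v.2 + 1) - g v) ^ 2 +
      (g (v.1 + 1, v.2 + b) - g (v.1 - 1, v.2 + b)) ^ 2) ≤ 4 * dirichlet g := by
  have h1 : (fun v : ℤ × ℤ => (g (v.1, v.2 + 1) - g v) ^ 2).HasFiniteSupport := by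
    simp only [sq]
    fun_prop (disch := first | (intro a b h; simpa [Prod.ext_iff] using h) | simp)
  have h2 : (fun v : ℤ × ℤ => (g (v.1 + 1, v.2) - g v) ^ 2).HasFiniteSupport := by
    simp only [sq]
    fun_prop (disch := first | (intro a b h; simpa [Prod.ext_iff] using h) | simp)
  have h3 : (fun v : ℤ × ℤ => (g (v.1 + 1, v.2 + b) -
      g (v.1 - 1, v.2 + b)) ^ 2).HasFiniteSupport := by
    simp only [sq]
    fun_prop (disch := first | (intro a b h; simpa [Prod.ext_iff] using h) | simp)
  have h4 := hasFiniteSupport_shift h2 0 b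
  have h5 := hasFiniteSupport_shift h2 (-1) b
  have e4 := tsum_shift (fun v : ℤ × ℤ => (g (v.1 + 1, v.2) - g v) ^ 2) 0 b
  have e5 := tsum_shift (fun v : ℤ × ℤ => (g (v.1 + 1, v.2) - g v) ^ 2) (-1) b
  have h45 := (h4.fun_add h5)
  have le3 : ∑' v : ℤ × ℤ, (g (v.1 + 1, v.2 + b) - g (v.1 - 1, v.2 + b)) ^ 2 ≤
      2 * (∑' v : ℤ × ℤ, (g (v.1 + 1, v.2) - g v) ^ 2 +
        ∑' v : ℤ × ℤ, (g (v.1 + 1, v.2) - g v) ^ 2) := by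
    nth_rewrite 1 [← e4]
    rw [← e5, ← Summable.tsum_add (summable_of_hasFiniteSupport h4)
      (summable_of_hasFiniteSupport h5), ← tsum_mul_left]
    refine Summable.tsum_le_tsum (fun v => ?_) (summable_of_hasFiniteSupport h3)
      ((summable_of_hasFiniteSupport h45).mul_left 2)
    have e2 : v.1 + -1 = v.1 - 1 := by ring
    simp only [add_zero, e2, sub_add_cancel]
    nlinarith [sq_nonneg (g (v.1 + 1, v.2 + b) - g (v.1, v.2 + b) -
      (g (v.1, v.2 + b) - g (v.1 - 1, v.2 + b)))]
  have nn : 0 ≤ ∑' v : ℤ × ℤ, (g (v.1, v.2 + 1) - g v) ^ 2 := tsum_nonneg fun v => sq_nonneg _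
  rw [dirichlet, Summable.tsum_add (summable_of_hasFiniteSupport h1)
    (summable_of_hasFiniteSupport h3), Summable.tsum_add (summable_of_hasFiniteSupport h2)
    (summable_of_hasFiniteSupport h1)]
  linarith

/-- The sector condition for the form of the walk. -/
lemma form_le_dirichlet_add {ε : ℤ → ℤ} (hε : ∀ y, ε y = 1 ∨ ε y = -1) {s : ℤ → ℝ}
    (hs : ∀ y, s (y + 1) = s y + ε y) {S : ℝ} (hS : ∀ y, |s y| ≤ S) {g h : ℤ × ℤ → ℝ}
    (hg : g.HasFiniteSupport) (hh : h.HasFiniteSupport) {t : ℝ} (ht : 0 < t) :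
    6 * ∑' v, (g v - adjointStep ε g v) * h v ≤
      (1 + 2 * S) * (t * dirichlet g + dirichlet h / t) := by
  have hS0 : 0 ≤ S := (abs_nonneg _).trans (hS 0)
  have hDg : (fun v : ℤ × ℤ => (g (v.1 + 1, v.2) - g v) ^ 2 +
      (g (v.1, v.2 + 1) - g v) ^ 2).HasFiniteSupport := by
    simp only [sq]
    fun_prop (disch := first | (intro a b h; simpa [Prod.ext_iff] using h) | simp)
  have hDh : (fun v : ℤ × ℤ => (h (v.1 + 1, v.2) - h v) ^ 2 +
      (h (v.1, v.2 + 1) - h v) ^ 2).HasFiniteSupport := by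
    simp only [sq]
    fun_prop (disch := first | (intro a b h; simpa [Prod.ext_iff] using h) | simp)
  have hAg : (fun v : ℤ × ℤ => (g (v.1, v.2 + 1) - g v) ^ 2 +
      (g (v.1 + 1, v.2 + 0) - g (v.1 - 1, v.2 + 0)) ^ 2).HasFiniteSupport := by
    simp only [sq]
    fun_prop (disch := first | (intro a b h; simpa [Prod.ext_iff] using h) | simp)
  have hAh : (fun v : ℤ × ℤ => (h (v.1, v.2 + 1) - h v) ^ 2 +
      (h (v.1 + 1, v.2 + 1) - h (v.1 - 1, v.2 + 1)) ^ 2).HasFiniteSupport := by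
    simp only [sq]
    fun_prop (disch := first | (intro a b h; simpa [Prod.ext_iff] using h) | simp)
  have sDg : Summable _ := (summable_of_hasFiniteSupport hDg).mul_left t
  have sDh : Summable _ := (summable_of_hasFiniteSupport hDh).mul_left t⁻¹
  have sAg : Summable _ := (summable_of_hasFiniteSupport hAg).mul_left (S / 2 * t)
  have sAh : Summable _ := (summable_of_hasFiniteSupport hAh).mul_left (S / 2 * t⁻¹)
  have bg := tsum_sq_sub_le_dirichlet hg 0
  have bh := tsum_sq_sub_le_dirichlet hh 1
  have ht' : 0 < t⁻¹ := inv_pos.2 ht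
  rw [six_mul_form_eq hε hs g hh]
  calc
    _ ≤ ∑' v : ℤ × ℤ, ((t * ((g (v.1 + 1, v.2) - g v) ^ 2 + (g (v.1, v.2 + 1) - g v) ^ 2) +
          t⁻¹ * ((h (v.1 + 1, v.2) - h v) ^ 2 + (h (v.1, v.2 + 1) - h v) ^ 2)) +
        (S / 2 * t * ((g (v.1, v.2 + 1) - g v) ^ 2 +
            (g (v.1 + 1, v.2 + 0) - g (v.1 - 1, v.2 + 0)) ^ 2) +
          S / 2 * t⁻¹ * ((h (v.1, v.2 + 1) - h v) ^ 2 +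
            (h (v.1 + 1, v.2 + 1) - h (v.1 - 1, v.2 + 1)) ^ 2))) := by
      refine Summable.tsum_le_tsum (fun v => ?_) (summable_of_hasFiniteSupport ?_)
        ((sDg.add sDh).add (sAg.add sAh))
      · simp only [add_zero]
        generalize g (v.1, v.2 + 1) - g v = a
        generalize h (v.1, v.2 + 1) - h v = b
        generalize g (v.1 + 1, v.2) - g v = c
        generalize h (v.1 + 1, v.2) - h v = d
        generalize g (v.1 + 1, v.2) - g (v.1 - 1, v.2) = p
        generalize h (v.1 + 1, v.2 + 1) - h (v.1 - 1, v.2 + 1) = q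
        have i1 := two_mul_mul_le_add_div ht a b
        have i2 := two_mul_mul_le_add_div ht c d
        have i3 := two_mul_mul_le_add_div ht |a| |q|
        have i4 := two_mul_mul_le_add_div ht |p| |b|
        simp only [sq_abs, div_eq_mul_inv] at i1 i2 i3 i4
        have i5 : s (v.2 + 1) * (a * q - p * b) ≤ S * (|a| * |q| + |p| * |b|) := by
          refine (le_abs_self _).trans ?_
          rw [abs_mul]
          refine mul_le_mul (hS _) ?_ (abs_nonneg _) hS0
          rw [← abs_mul, ← abs_mul]
          exact abs_sub _ _
        have i6 := mul_le_mul_of_nonneg_left (add_le_add i3 i4) (by positivity : 0 ≤ S / 2)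
        have n1 : 0 ≤ t * c ^ 2 := by positivity
        have n2 : 0 ≤ t⁻¹ * d ^ 2 := by positivity
        nlinarith
      · fun_prop (disch := first | (intro a b h; simpa [Prod.ext_iff] using h) | simp)
    _ = t * dirichlet g + t⁻¹ * dirichlet h +
        (S / 2 * t * (∑' v : ℤ × ℤ, ((g (v.1, v.2 + 1) - g v) ^ 2 +
            (g (v.1 + 1, v.2 + 0) - g (v.1 - 1, v.2 + 0)) ^ 2)) +
          S / 2 * t⁻¹ * (∑' v : ℤ × ℤ, ((h (v.1, v.2 + 1) - h v) ^ 2 +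
            (h (v.1 + 1, v.2 + 1) - h (v.1 - 1, v.2 + 1)) ^ 2))) := by
      rw [(sDg.add sDh).tsum_add (sAg.add sAh), sDg.tsum_add sDh, sAg.tsum_add sAh,
        tsum_mul_left, tsum_mul_left, tsum_mul_left, tsum_mul_left, dirichlet, dirichlet]
    _ ≤ t * dirichlet g + t⁻¹ * dirichlet h +
        (S / 2 * t * (4 * dirichlet g) + S / 2 * t⁻¹ * (4 * dirichlet h)) := by
      gcongr
    _ = _ := by
      rw [div_eq_mul_inv]
      ring

/-! ### Logarithmic cutoffs and zero capacity -/

/-- The sup-norm of a lattice point. -/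
def boxNorm (v : ℤ × ℤ) : ℕ := max v.1.natAbs v.2.natAbs

/-- The partial sums of the harmonic series. -/
noncomputable def harmonicSum (r : ℕ) : ℝ := ∑ k ∈ Finset.range r, 1 / ((k : ℝ) + 1)

lemma harmonicSum_succ (r : ℕ) : harmonicSum (r + 1) = harmonicSum r + 1 / ((r : ℝ) + 1) :=
  Finset.sum_range_succ _ _

lemma harmonicSum_mono : Monotone harmonicSum :=
  monotone_nat_of_le_succ fun n => by
    rw [harmonicSum_succ]
    have : (0 : ℝ) ≤ 1 / ((n : ℝ) + 1) := by positivity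
    linarith

lemma one_le_harmonicSum {N : ℕ} (hN : 1 ≤ N) : 1 ≤ harmonicSum N := by
  simpa [harmonicSum] using harmonicSum_mono hN

/-- The logarithmic cutoff at scale `N`. -/
noncomputable def logCutoff (N : ℕ) (v : ℤ × ℤ) : ℝ :=
  max 0 (1 - harmonicSum (boxNorm v) / harmonicSum N)

lemma logCutoff_eq_zero {N : ℕ} (hN : 1 ≤ N) {v : ℤ × ℤ} (hv : N ≤ boxNorm v) :
    logCutoff N v = 0 := by
  have h1 := one_le_harmonicSum hN
  have h2 := harmonicSum_mono hv
  rw [logCutoff, max_eq_left]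
  rw [sub_nonpos, le_div_iff₀ (by linarith)]
  linarith

/-- Adjacent radii change the harmonic sum by at most `2 / (r + 1)`; the `2` pays for inward steps,
where the change is `1 / r`. The sphere of radius `N` is included since it has neighbours inside. -/
lemma logCutoff_sub_sq_le {N : ℕ} (hN : 1 ≤ N) {v w : ℤ × ℤ} (h1 : boxNorm w ≤ boxNorm v + 1)
    (h2 : boxNorm v ≤ boxNorm w + 1) :
    (logCutoff N w - logCutoff N v) ^ 2 ≤
      if boxNorm v ≤ N then 4 / (((boxNorm v : ℝ) + 1) ^ 2 * harmonicSum N ^ 2) else 0 := by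
  have hL := one_le_harmonicSum hN
  split_ifs with h
  · have key : |harmonicSum (boxNorm w) - harmonicSum (boxNorm v)| ≤ 2 / ((boxNorm v : ℝ) + 1) := by
      generalize boxNorm w = a at *
      generalize boxNorm v = b at *
      have hb : (0 : ℝ) < (b : ℝ) + 1 := by positivity
      rcases (by omega : a = b + 1 ∨ a = b ∨ b = a + 1) with rfl | rfl | rfl
      · rw [harmonicSum_succ, add_sub_cancel_left, abs_of_nonneg (by positivity)]
        gcongr
        norm_num
      · simp only [sub_self, abs_zero]
        positivity
      · rw [harmonicSum_succ, sub_add_cancel_left, abs_neg, abs_of_nonneg (by positivity)]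
        push_cast
        rw [div_le_div_iff₀ (by positivity) (by positivity)]
        have : (0 : ℝ) ≤ a := by positivity
        linarith
    have key2 : |logCutoff N w - logCutoff N v| ≤
        2 / ((boxNorm v : ℝ) + 1) / harmonicSum N := by
      calc _ ≤ |(1 - harmonicSum (boxNorm w) / harmonicSum N) -
            (1 - harmonicSum (boxNorm v) / harmonicSum N)| := by
            have := abs_max_sub_max_le_abs (1 - harmonicSum (boxNorm w) / harmonicSum N)
              (1 - harmonicSum (boxNorm v) / harmonicSum N) 0
            simpa only [logCutoff, max_comm] using this
        _ = |harmonicSum (boxNorm w) - harmonicSum (boxNorm v)| / harmonicSum N := by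
            rw [sub_sub_sub_cancel_left, ← sub_div, abs_div, abs_of_nonneg (by linarith :
              0 ≤ harmonicSum N), abs_sub_comm]
        _ ≤ _ := by gcongr
    calc _ = |logCutoff N w - logCutoff N v| ^ 2 := (sq_abs _).symm
      _ ≤ (2 / ((boxNorm v : ℝ) + 1) / harmonicSum N) ^ 2 := by gcongr
      _ = _ := by
        rw [div_pow, div_pow, div_div]
        norm_num
  · rw [logCutoff_eq_zero hN (by omega), logCutoff_eq_zero hN (by omega)]
    norm_num

lemma logCutoff_hasFiniteSupport {N : ℕ} (hN : 1 ≤ N) : (logCutoff N).HasFiniteSupport := by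
  refine (Set.finite_Icc ((-(N : ℤ), -(N : ℤ)) : ℤ × ℤ) ((N : ℤ), (N : ℤ))).subset fun v hv => ?_
  by_contra h
  refine hv (logCutoff_eq_zero hN ?_)
  by_contra h'
  apply h
  simp only [boxNorm] at h'
  rw [Set.mem_Icc, Prod.le_def, Prod.le_def]
  refine ⟨⟨?_, ?_⟩, ?_, ?_⟩ <;> simp only <;> omega

/-- The sphere of radius `r` has at most `8 * (r + 1)` points, each of energy at most `8 / ((r + 1)
* H_N) ^ 2` up to the weight of `H_N`, so the total is of order `H_N / H_N ^ 2`. This decay is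
special to dimension two. -/
lemma dirichlet_logCutoff_le {N : ℕ} (hN : 1 ≤ N) :
    dirichlet (logCutoff N) ≤ 128 / harmonicSum N := by
  have hL := one_le_harmonicSum hN
  set F : ℕ → ℝ := fun r => 8 / (((r : ℝ) + 1) ^ 2 * harmonicSum N ^ 2) with hF
  have hFnn : ∀ r, 0 ≤ F r := fun r => by positivity
  have hpt : ∀ v : ℤ × ℤ, (logCutoff N (v.1 + 1, v.2) - logCutoff N v) ^ 2 +
      (logCutoff N (v.1, v.2 + 1) - logCutoff N v) ^ 2 ≤
      if boxNorm v ≤ N then F (boxNorm v) else 0 := by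
    intro v
    have i1 := logCutoff_sub_sq_le hN (v := v) (w := (v.1 + 1, v.2))
      (by simp only [boxNorm]; omega) (by simp only [boxNorm]; omega)
    have i2 := logCutoff_sub_sq_le hN (v := v) (w := (v.1, v.2 + 1))
      (by simp only [boxNorm]; omega) (by simp only [boxNorm]; omega)
    refine (add_le_add i1 i2).trans (le_of_eq ?_)
    split_ifs
    · rw [hF]
      ring
    · ring
  let s : Finset (ℤ × ℤ) := (Finset.range (N + 1)).biUnion fun r => Finset.box r
  have hs : ∀ v, v ∉ s → ¬ boxNorm v ≤ N := by
    intro v hv h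
    apply hv
    simp only [s, Finset.mem_biUnion, Finset.mem_range]
    exact ⟨boxNorm v, by omega, Int.mem_box.2 rfl⟩
  have hzero : ∀ v, v ∉ s → (logCutoff N (v.1 + 1, v.2) - logCutoff N v) ^ 2 +
      (logCutoff N (v.1, v.2 + 1) - logCutoff N v) ^ 2 = 0 := by
    intro v hv
    refine le_antisymm ?_ (by positivity)
    simpa [hs v hv] using hpt v
  rw [dirichlet, tsum_eq_sum hzero]
  calc _ ≤ ∑ v ∈ s, F (boxNorm v) := by
        refine Finset.sum_le_sum fun v _ => (hpt v).trans ?_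
        split_ifs
        · exact le_rfl
        · exact hFnn _
    _ = ∑ r ∈ Finset.range (N + 1), ∑ v ∈ (Finset.box r : Finset (ℤ × ℤ)), F (boxNorm v) := by
        refine Finset.sum_biUnion fun a _ b _ hab => Finset.disjoint_left.2 fun v hva hvb => hab ?_
        rw [← Int.mem_box.1 hva, ← Int.mem_box.1 hvb]
    _ ≤ ∑ r ∈ Finset.range (N + 1), 64 / harmonicSum N ^ 2 * (1 / ((r : ℝ) + 1)) := by
        refine Finset.sum_le_sum fun r _ => ?_
        have hc : ((Finset.box r : Finset (ℤ × ℤ)).card : ℝ) ≤ 8 * ((r : ℝ) + 1) := by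
          rcases eq_or_ne r 0 with rfl | hr
          · norm_num
          · rw [Int.card_box hr]
            push_cast
            linarith
        calc _ = ∑ v ∈ (Finset.box r : Finset (ℤ × ℤ)), F r :=
              Finset.sum_congr rfl fun v hv => by rw [boxNorm, Int.mem_box.1 hv]
          _ = ((Finset.box r : Finset (ℤ × ℤ)).card : ℝ) * F r := by simp
          _ ≤ 8 * ((r : ℝ) + 1) * F r := mul_le_mul_of_nonneg_right hc (hFnn r)
          _ = _ := by
            rw [hF]
            field_simp
            norm_num
    _ = 64 / harmonicSum N ^ 2 * harmonicSum (N + 1) := by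
        rw [← Finset.mul_sum]
        rfl
    _ ≤ 64 / harmonicSum N ^ 2 * (2 * harmonicSum N) := by
        gcongr
        rw [harmonicSum_succ]
        have : 1 / ((N : ℝ) + 1) ≤ 1 := by
          rw [div_le_one (by positivity)]
          have : (0 : ℝ) ≤ N := by positivity
          linarith
        linarith
    _ = _ := by
        field_simp
        norm_num

/-- Points of the planar lattice have zero capacity. -/
lemma exists_dirichlet_lt (u : ℤ × ℤ) {η : ℝ} (hη : 0 < η) :
    ∃ h : ℤ × ℤ → ℝ, h.HasFiniteSupport ∧ h u = 1 ∧ dirichlet h < η := by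
  have hlim : Tendsto harmonicSum atTop atTop := Real.tendsto_sum_range_one_div_nat_succ_atTop
  obtain ⟨N, hN1, hN⟩ := ((eventually_ge_atTop 1).and
    (hlim.eventually_gt_atTop (128 / η))).exists
  have hL := one_le_harmonicSum hN1
  refine ⟨fun v => logCutoff N (v.1 + -u.1, v.2 + -u.2),
    hasFiniteSupport_shift (logCutoff_hasFiniteSupport hN1) _ _, ?_, ?_⟩
  · simp [logCutoff, boxNorm, harmonicSum]
  · have : dirichlet (fun v => logCutoff N (v.1 + -u.1, v.2 + -u.2)) = dirichlet (logCutoff N) := by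
      rw [dirichlet, dirichlet, ← tsum_shift (fun v =>
        (logCutoff N (v.1 + 1, v.2) - logCutoff N v) ^ 2 +
          (logCutoff N (v.1, v.2 + 1) - logCutoff N v) ^ 2) (-u.1) (-u.2)]
      simp only [add_right_comm]
    rw [this]
    refine (dirichlet_logCutoff_le hN1).trans_lt ?_
    rw [div_lt_iff₀ (by linarith)]
    rw [div_lt_iff₀ hη] at hN
    linarith

/-! ### Markov chains: infinite Green function implies recurrence -/

section MarkovChain

open scoped ENNReal

variable {S Ω : Type*} [MeasurableSpace S] [MeasurableSpace Ω]
  [MeasurableSingletonClass S] {P : S → S → ℝ} {u : S} {μ : Measure Ω} {M : ℕ → Ω → S}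

lemma IsMarkovChain.measurableSet_eq (hM : IsMarkovChain P u μ M) (n : ℕ) (v : S) :
    MeasurableSet {ω | M n ω = v} :=
  hM.measurable n (measurableSet_singleton v)

variable [Countable S]

lemma measure_eq_tsum_inter_preimage (μ : Measure Ω) {X : Ω → S} (hX : Measurable X) (E : Set Ω) :
    μ E = ∑' v, μ ({ω | X ω = v} ∩ E) := by
  have h := tsum_measure_preimage_singleton (μ := μ.restrict E) (Set.countable_univ (α := S))
    (f := X) fun y _ => hX (measurableSet_singleton y)
  rw [Set.preimage_univ, Measure.restrict_apply_univ, tsum_univ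
    (fun v => μ.restrict E (X ⁻¹' {v}))] at h
  rw [← h]
  exact tsum_congr fun v => Measure.restrict_apply (hX (measurableSet_singleton v))

namespace IsMarkovChain

/-- The Markov property, for events determined by the past. -/
lemma measure_inter_step [IsProbabilityMeasure μ] (hM : IsMarkovChain P u μ M)
    {n : ℕ} {A : Set Ω}
    (hA : ∀ ω ω', (∀ i ≤ n, M i ω = M i ω') → ω ∈ A → ω' ∈ A) (v w : S) :
    μ (A ∩ {ω | M n ω = v} ∩ {ω | M (n + 1) ω = w}) =
      μ (A ∩ {ω | M n ω = v}) * ENNReal.ofReal (P v w) := by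
  let X : Ω → (Fin (n + 1) → S) := fun ω i => M i ω
  have hX : Measurable X := measurable_pi_lambda _ fun i => hM.measurable i
  rw [measure_eq_tsum_inter_preimage μ hX (A ∩ {ω | M n ω = v} ∩ {ω | M (n + 1) ω = w}),
    measure_eq_tsum_inter_preimage μ hX (A ∩ {ω | M n ω = v}), ← ENNReal.tsum_mul_right]
  refine tsum_congr fun x => ?_
  by_cases hx : ∃ ω₀ ∈ A ∩ {ω | M n ω = v}, X ω₀ = x
  · obtain ⟨ω₀, ⟨hω₀, hv⟩, rfl⟩ := hx
    -- The default value `w` makes `y` the observed past extended by the prescribed next state.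
    let y : ℕ → S := fun i => if i ≤ n then M i ω₀ else w
    have hyle : ∀ i ≤ n, y i = M i ω₀ := fun i hi => if_pos hi
    have hyn : y n = v := (hyle n le_rfl).trans hv
    have hyw : y (n + 1) = w := if_neg (by omega)
    have hXiff : ∀ ω, X ω = X ω₀ ↔ ∀ i ≤ n, M i ω = y i := by
      intro ω
      constructor
      · intro h i hi
        rw [hyle i hi]
        exact congrFun h ⟨i, by omega⟩
      · intro h
        funext i
        exact (h i (by omega)).trans (hyle i (by omega))
    have e1 : {ω | X ω = X ω₀} ∩ (A ∩ {ω | M n ω = v}) = {ω | ∀ i ≤ n, M i ω = y i} := by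
      ext ω
      simp only [Set.mem_inter_iff, Set.mem_ofPred_eq, hXiff]
      refine ⟨fun h => h.1, fun h => ⟨h, hA ω₀ ω (fun i hi => ?_) hω₀, (h n le_rfl).trans hyn⟩⟩
      rw [h i hi, hyle i hi]
    have e2 : {ω | X ω = X ω₀} ∩ (A ∩ {ω | M n ω = v} ∩ {ω | M (n + 1) ω = w}) =
        {ω | ∀ i ≤ n + 1, M i ω = y i} := by
      rw [← Set.inter_assoc, e1]
      ext ω
      simp only [Set.mem_inter_iff, Set.mem_ofPred_eq]
      constructor
      · rintro ⟨h, h'⟩ i hi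
        rcases Nat.le_succ_iff.1 hi with hi | rfl
        · exact h i hi
        · exact h'.trans hyw.symm
      · exact fun h => ⟨fun i hi => h i (by omega), (h _ le_rfl).trans hyw⟩
    have hstep := hM.step n y
    rw [hyn, hyw] at hstep
    rw [e1, e2, ← ofReal_measureReal (s := {ω | ∀ i ≤ n + 1, M i ω = y i}), hstep,
      ENNReal.ofReal_mul measureReal_nonneg, ofReal_measureReal]
  · have e1 : {ω | X ω = x} ∩ (A ∩ {ω | M n ω = v}) = ∅ := by
      ext ω
      simp only [Set.mem_inter_iff, Set.mem_ofPred_eq, Set.mem_empty_iff_false, iff_false]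
      exact fun h => hx ⟨ω, h.2, h.1⟩
    rw [← Set.inter_assoc, e1]
    simp

lemma measure_succ [IsProbabilityMeasure μ] (hM : IsMarkovChain P u μ M)
    (n : ℕ) (w : S) :
    μ {ω | M (n + 1) ω = w} = ∑' v, μ {ω | M n ω = v} * ENNReal.ofReal (P v w) := by
  rw [measure_eq_tsum_inter_preimage μ (hM.measurable n)]
  refine tsum_congr fun v => ?_
  simpa using hM.measure_inter_step (A := Set.univ) (fun _ _ _ _ => trivial) v w

open Classical in
/-- The probability that the chain with transition matrix `P`, started at `v`, does not visit `u`
at the times `1, …, m`. -/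
noncomputable def avoidProb (P : S → S → ℝ) (u : S) : ℕ → S → ℝ≥0∞
  | 0, _ => 1
  | m + 1, v => ∑' w, if w = u then 0 else ENNReal.ofReal (P v w) * avoidProb P u m w

/-- The Markov property for a future avoidance event, with a factor independent of `n`. In the
induction the past event absorbs `M n = v`, so it must vary along with `n`. -/
lemma measure_inter_avoid [IsProbabilityMeasure μ] (hM : IsMarkovChain P u μ M)
    (a : S) (m : ℕ) {n : ℕ} {A : Set Ω}
    (hA : ∀ ω ω', (∀ i ≤ n, M i ω = M i ω') → ω ∈ A → ω' ∈ A) (v : S) :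
    μ (A ∩ {ω | M n ω = v} ∩ {ω | ∀ k < m, M (n + 1 + k) ω ≠ a}) =
      μ (A ∩ {ω | M n ω = v}) * avoidProb P a m v := by
  induction m generalizing n A v with
  | zero => simp [avoidProb]
  | succ m ih =>
    rw [measure_eq_tsum_inter_preimage μ (hM.measurable (n + 1)), avoidProb,
      ← ENNReal.tsum_mul_left]
    refine tsum_congr fun w => ?_
    split_ifs with hw
    · rw [mul_zero]
      convert measure_empty (μ := μ)
      ext ω
      simp only [Set.mem_inter_iff, Set.mem_ofPred_eq, Set.mem_empty_iff_false, iff_false]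
      exact fun h => h.2.2 0 (by omega) (h.1.trans hw)
    · have hA' : ∀ ω ω', (∀ i ≤ n + 1, M i ω = M i ω') → ω ∈ A ∩ {ω | M n ω = v} →
          ω' ∈ A ∩ {ω | M n ω = v} := fun ω ω' h hω =>
        ⟨hA ω ω' (fun i hi => h i (by omega)) hω.1, (h n (by omega)).symm.trans hω.2⟩
      have e : {ω | M (n + 1) ω = w} ∩
          (A ∩ {ω | M n ω = v} ∩ {ω | ∀ k < m + 1, M (n + 1 + k) ω ≠ a}) =
          A ∩ {ω | M n ω = v} ∩ {ω | M (n + 1) ω = w} ∩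
            {ω | ∀ k < m, M (n + 1 + 1 + k) ω ≠ a} := by
        ext ω
        simp only [Set.mem_inter_iff, Set.mem_ofPred_eq]
        constructor
        · rintro ⟨h1, h2, h3⟩
          refine ⟨⟨h2, h1⟩, fun k hk => ?_⟩
          have := h3 (k + 1) (by omega)
          rwa [show n + 1 + (k + 1) = n + 1 + 1 + k by ring] at this
        · rintro ⟨⟨h2, h1⟩, h3⟩
          refine ⟨h1, h2, fun k hk => ?_⟩
          rcases k with _ | k
          · rw [add_zero, h1]
            exact hw
          · have := h3 k (by omega)
            rwa [show n + 1 + 1 + k = n + 1 + (k + 1) by ring] at this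
      rw [e, ih hA' w, hM.measure_inter_step hA, mul_assoc]

/-- By decomposing at the last visit, a Markov chain whose expected number of returns to its
starting point is infinite almost surely returns there infinitely often. -/
theorem frequently_eq_of_tsum_eq_top [IsProbabilityMeasure μ] (hM : IsMarkovChain P u μ M)
    (h : ∑' n, μ {ω | M n ω = u} = ∞) :
    ∀ᵐ ω ∂μ, ∃ᶠ n in atTop, M n ω = u := by
  let B : ℕ → ℕ → Set Ω := fun n m => {ω | M n ω = u} ∩ {ω | ∀ k < m, M (n + 1 + k) ω ≠ u}
  let L : ℕ → Set Ω := fun n => ⋂ m, B n m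
  have hBmeas : ∀ n m, MeasurableSet (B n m) := fun n m => by
    refine (hM.measurableSet_eq n u).inter ?_
    have : {ω | ∀ k < m, M (n + 1 + k) ω ≠ u} =
        ⋂ k, ⋂ (_ : k < m), {ω | M (n + 1 + k) ω = u}ᶜ := by
      ext ω
      simp
    rw [this]
    exact MeasurableSet.iInter fun k => MeasurableSet.iInter fun _ =>
      (hM.measurableSet_eq _ u).compl
  have hBanti : ∀ n, Antitone (B n) := fun n m m' hmm ω hω =>
    ⟨hω.1, fun k hk => hω.2 k (by omega)⟩
  have hB : ∀ n m, μ (B n m) = μ {ω | M n ω = u} * avoidProb P u m u := fun n m => by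
    simpa using hM.measure_inter_avoid u m (n := n) (A := Set.univ) (fun _ _ _ _ => trivial) u
  have hlim : ∀ n, Tendsto (fun m => μ (B n m)) atTop (nhds (μ (L n))) := fun n =>
    tendsto_measure_iInter_atTop (fun m => (hBmeas n m).nullMeasurableSet) (hBanti n)
      ⟨0, measure_ne_top _ _⟩
  have hstart : μ {ω | M 0 ω = u} = 1 := 
    (mem_ae_iff_prob_eq_one (hM.measurableSet_eq 0 u)).1 hM.start
  have hq : Tendsto (fun m => avoidProb P u m u) atTop (nhds (μ (L 0))) := by
    simpa [hB, hstart] using hlim 0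
  -- `L n` says that `n` is the last visit to `u`; after any visit the escape probability is the
  -- same, `μ (L 0)`.
  have hL : ∀ n, μ (L n) = μ {ω | M n ω = u} * μ (L 0) := fun n => by
    refine tendsto_nhds_unique (hlim n) ?_
    simp only [hB]
    exact ENNReal.Tendsto.const_mul hq (Or.inr (measure_ne_top _ _))
  have hmemL : ∀ n ω, ω ∈ L n ↔ M n ω = u ∧ ∀ k, M (n + 1 + k) ω ≠ u := by
    intro n ω
    simp only [L, B, Set.mem_iInter, Set.mem_inter_iff, Set.mem_ofPred_eq]
    exact ⟨fun h => ⟨(h 0).1, fun k => (h (k + 1)).2 k (by omega)⟩,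
      fun h m => ⟨h.1, fun k _ => h.2 k⟩⟩
  have hdisj : Pairwise (Function.onFun Disjoint L) := by
    have aux : ∀ i j, i < j → Disjoint (L i) (L j) := fun i j hij =>
      Set.disjoint_left.2 fun ω hi hj => by
        have h1 := ((hmemL i ω).1 hi).2 (j - (i + 1))
        rw [show i + 1 + (j - (i + 1)) = j by omega] at h1
        exact h1 ((hmemL j ω).1 hj).1
    intro i j hij
    rcases lt_or_gt_of_ne hij with h | h
    · exact aux i j h
    · exact (aux j i h).symm
  -- Last-visit events are disjoint, so an infinite Green function forces `μ (L 0) = 0`.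
  have hsum : (∑' n, μ {ω | M n ω = u}) * μ (L 0) ≤ 1 := by
    rw [← ENNReal.tsum_mul_right]
    simp only [← hL]
    rw [← measure_iUnion hdisj fun n => MeasurableSet.iInter fun m => hBmeas n m]
    exact prob_le_one
  have hL0 : μ (L 0) = 0 := by
    by_contra h0
    rw [h, ENNReal.top_mul h0] at hsum
    exact absurd hsum (by simp)
  have hnull : ∀ᵐ ω ∂μ, ∀ n, ω ∉ L n := ae_all_iff.2 fun n => by
    rw [← measure_eq_zero_iff_ae_notMem, hL, hL0, mul_zero]
  filter_upwards [hM.start, hnull] with ω h0 hω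
  by_contra hfreq
  rw [not_frequently, eventually_atTop] at hfreq
  classical
  -- With only finitely many visits, let `N` be the least time from which `u` is avoided. It is
  -- positive because of the start, and its predecessor is the last visit.
  have hspec := Nat.find_spec hfreq
  have hmin := fun m => Nat.find_min hfreq (m := m)
  generalize Nat.find hfreq = N at hspec hmin
  rcases N with _ | N
  · exact hspec 0 le_rfl h0
  · refine hω N ((hmemL N ω).2 ⟨?_, fun k => hspec _ (by omega)⟩)
    by_contra hne
    refine hmin N (by omega) fun b hb => ?_
    rcases hb.eq_or_lt with rfl | hb
    · exact hne
    · exact hspec b hb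

end IsMarkovChain

end MarkovChain

/-! ### Truncated Green function and divergence -/

/-- The distribution at time `n` of the walk with orientations `ε` started at `u`. -/
noncomputable def walkLaw (ε : ℤ → ℤ) (u : ℤ × ℤ) : ℕ → ℤ × ℤ → ℝ
  | 0 => Pi.single u 1
  | n + 1 => adjointStep ε (walkLaw ε u n)

lemma walkLaw_nonneg (ε : ℤ → ℤ) (u : ℤ × ℤ) (n : ℕ) (v : ℤ × ℤ) : 0 ≤ walkLaw ε u n v := by
  induction n generalizing v with
  | zero =>
    rw [walkLaw, Pi.single_apply]
    split_ifs <;> norm_num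
  | succ n ih =>
    have h1 := ih (v.1, v.2 + 1)
    have h2 := ih (v.1, v.2 - 1)
    have h3 := ih (v.1 - ε v.2, v.2)
    simp only [walkLaw, adjointStep]
    positivity

lemma adjointStep_hasFiniteSupport (ε : ℤ → ℤ) {g : ℤ × ℤ → ℝ} (hg : g.HasFiniteSupport) :
    (adjointStep ε g).HasFiniteSupport := by
  have h3 : (fun v : ℤ × ℤ => g (v.1 - ε v.2, v.2)).HasFiniteSupport := by
    refine hg.fun_comp_of_injective (g := fun v : ℤ × ℤ => (v.1 - ε v.2, v.2)) fun a b h => ?_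
    simp only [Prod.ext_iff] at h ⊢
    obtain ⟨h1, h2⟩ := h
    rw [h2] at h1
    exact ⟨by linarith, h2⟩
  have h12 : (fun v : ℤ × ℤ => g (v.1, v.2 + 1) + g (v.1, v.2 - 1)).HasFiniteSupport := by
    fun_prop (disch := first | (intro a b h; simpa [Prod.ext_iff] using h) | simp)
  exact (h12.fun_add h3).fun_comp (g := fun x : ℝ => x / 3) (by simp)

lemma walkLaw_hasFiniteSupport (ε : ℤ → ℤ) (u : ℤ × ℤ) (n : ℕ) :
    (walkLaw ε u n).HasFiniteSupport := by
  induction n with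
  | zero =>
    refine (Set.finite_singleton u).subset fun v hv => ?_
    by_contra h
    exact hv (Pi.single_eq_of_ne h 1)
  | succ n ih => exact adjointStep_hasFiniteSupport ε ih

/-- The expected number of visits before time `T` of the walk started at `u`. -/
noncomputable def occupation (ε : ℤ → ℤ) (u : ℤ × ℤ) (T : ℕ) (v : ℤ × ℤ) : ℝ :=
  ∑ n ∈ Finset.range T, walkLaw ε u n v

lemma occupation_hasFiniteSupport (ε : ℤ → ℤ) (u : ℤ × ℤ) (T : ℕ) :
    (occupation ε u T).HasFiniteSupport :=
  HasFiniteSupport.sum (fun n => walkLaw_hasFiniteSupport ε u n) _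

lemma occupation_nonneg (ε : ℤ → ℤ) (u : ℤ × ℤ) (T : ℕ) (v : ℤ × ℤ) : 0 ≤ occupation ε u T v :=
  Finset.sum_nonneg fun n _ => walkLaw_nonneg ε u n v

lemma occupation_sub_adjointStep (ε : ℤ → ℤ) (u : ℤ × ℤ) (T : ℕ) (v : ℤ × ℤ) :
    occupation ε u T v - adjointStep ε (occupation ε u T) v =
      walkLaw ε u 0 v - walkLaw ε u T v := by
  induction T with
  | zero => simp [occupation, adjointStep]
  | succ T ih =>
    have h : walkLaw ε u (T + 1) v = adjointStep ε (walkLaw ε u T) v := rfl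
    simp only [occupation, adjointStep, Finset.sum_range_succ] at *
    rw [h]
    linarith

lemma form_occupation (ε : ℤ → ℤ) (u : ℤ × ℤ) (T : ℕ) {h : ℤ × ℤ → ℝ} (hh : h.HasFiniteSupport) :
    ∑' v, (occupation ε u T v - adjointStep ε (occupation ε u T) v) * h v =
      h u - ∑' v, walkLaw ε u T v * h v := by
  simp only [occupation_sub_adjointStep, sub_mul]
  rw [Summable.tsum_sub (summable_of_hasFiniteSupport (hasFiniteSupport_mul_right _ hh))
    (summable_of_hasFiniteSupport (hasFiniteSupport_mul_right _ hh)), tsum_eq_single u]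
  · simp [walkLaw]
  · intro v hv
    simp [walkLaw, hv]

/-- The form is tested against the occupation function itself; the term at time `T` has a favourable
sign. -/
lemma dirichlet_occupation_le {ε : ℤ → ℤ} (hε : ∀ y, ε y = 1 ∨ ε y = -1) (u : ℤ × ℤ) (T : ℕ) :
    dirichlet (occupation ε u T) ≤ 6 * occupation ε u T u := by
  have h := dirichlet_le_form hε (occupation_hasFiniteSupport ε u T)
  rw [form_occupation ε u T (occupation_hasFiniteSupport ε u T)] at h
  have : 0 ≤ ∑' v, walkLaw ε u T v * occupation ε u T v :=
    tsum_nonneg fun v => mul_nonneg (walkLaw_nonneg ε u T v) (occupation_nonneg ε u T v)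
  linarith

lemma sq_sub_le_dirichlet {g : ℤ × ℤ → ℝ} (hg : g.HasFiniteSupport) (v : ℤ × ℤ) :
    (g (v.1 + 1, v.2) - g v) ^ 2 + (g (v.1, v.2 + 1) - g v) ^ 2 ≤ dirichlet g := by
  have h : (fun v : ℤ × ℤ =>
      (g (v.1 + 1, v.2) - g v) ^ 2 + (g (v.1, v.2 + 1) - g v) ^ 2).HasFiniteSupport := by
    simp only [sq]
    fun_prop (disch := first | (intro a b h; simpa [Prod.ext_iff] using h) | simp)
  exact (summable_of_hasFiniteSupport h).le_tsum v fun w _ => by positivity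

/-- Bounded energy bounds every edge increment by `1 + D`, so a bound at `u` propagates along its
row and then a column. Applied to occupations, this replaces an irreducibility argument. -/
lemma exists_forall_le_of_dirichlet_le {g : ℕ → ℤ × ℤ → ℝ} (hg : ∀ T, (g T).HasFiniteSupport)
    {D G : ℝ} (hD : ∀ T, dirichlet (g T) ≤ D) {u : ℤ × ℤ} (hG : ∀ T, g T u ≤ G) (v : ℤ × ℤ) :
    ∃ C, ∀ T, g T v ≤ C := by
  have hx : ∀ T a b, |g T (a + 1, b) - g T (a, b)| ≤ 1 + D := fun T a b => by
    have h1 := (sq_sub_le_dirichlet (hg T) (a, b)).trans (hD T)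
    have h2 := sq_nonneg (g T (a, b + 1) - g T (a, b))
    simp only at h1
    rw [← sq_abs (g T (a + 1, b) - g T (a, b))] at h1
    nlinarith [sq_nonneg (|g T (a + 1, b) - g T (a, b)| - 1)]
  have hy : ∀ T a b, |g T (a, b + 1) - g T (a, b)| ≤ 1 + D := fun T a b => by
    have h1 := (sq_sub_le_dirichlet (hg T) (a, b)).trans (hD T)
    have h2 := sq_nonneg (g T (a + 1, b) - g T (a, b))
    simp only at h1
    rw [← sq_abs (g T (a, b + 1) - g T (a, b))] at h1
    nlinarith [sq_nonneg (|g T (a, b + 1) - g T (a, b)| - 1)]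
  have hrow : ∀ k : ℤ, ∃ C, ∀ T, g T (u.1 + k, u.2) ≤ C := by
    intro k
    induction k using Int.induction_on with
    | zero => exact ⟨G, fun T => by simpa using hG T⟩
    | succ i ih =>
      obtain ⟨C, hC⟩ := ih
      refine ⟨C + (1 + D), fun T => ?_⟩
      have h1 := (abs_le.1 (hx T (u.1 + i) u.2)).2
      rw [← add_assoc]
      linarith [hC T]
    | pred i ih =>
      obtain ⟨C, hC⟩ := ih
      refine ⟨C + (1 + D), fun T => ?_⟩
      have h1 := (abs_le.1 (hx T (u.1 + (-i - 1)) u.2)).1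
      rw [show u.1 + (-(i : ℤ) - 1) + 1 = u.1 + -i by ring] at h1
      linarith [hC T]
  have hall : ∀ k : ℤ, ∃ C, ∀ T, g T (v.1, u.2 + k) ≤ C := by
    intro k
    induction k using Int.induction_on with
    | zero =>
      obtain ⟨C, hC⟩ := hrow (v.1 - u.1)
      exact ⟨C, fun T => by simpa using hC T⟩
    | succ i ih =>
      obtain ⟨C, hC⟩ := ih
      refine ⟨C + (1 + D), fun T => ?_⟩
      have h1 := (abs_le.1 (hy T v.1 (u.2 + i))).2
      rw [← add_assoc]
      linarith [hC T]
    | pred i ih =>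
      obtain ⟨C, hC⟩ := ih
      refine ⟨C + (1 + D), fun T => ?_⟩
      have h1 := (abs_le.1 (hy T v.1 (u.2 + (-i - 1)))).1
      rw [show u.2 + (-(i : ℤ) - 1) + 1 = u.2 + -i by ring] at h1
      linarith [hC T]
  obtain ⟨C, hC⟩ := hall (v.2 - u.2)
  exact ⟨C, fun T => by simpa using hC T⟩

/-- If the orientations are the increments of a bounded sequence, then the expected number of
returns of the walk to its starting point is infinite. -/
theorem not_summable_walkLaw {ε : ℤ → ℤ} (hε : ∀ y, ε y = 1 ∨ ε y = -1) {s : ℤ → ℝ}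
    (hs : ∀ y, s (y + 1) = s y + ε y) {S : ℝ} (hS : ∀ y, |s y| ≤ S) (u : ℤ × ℤ) :
    ¬ Summable fun n => walkLaw ε u n u := by
  intro hsum
  have hS0 : 0 ≤ S := (abs_nonneg _).trans (hS 0)
  obtain ⟨G, hG1, hG⟩ : ∃ G : ℝ, 0 < G ∧ ∀ T, occupation ε u T u ≤ G := by
    refine ⟨1 + ∑' n, walkLaw ε u n u, ?_, fun T => ?_⟩
    · have : 0 ≤ ∑' n, walkLaw ε u n u := tsum_nonneg fun n => walkLaw_nonneg ε u n u
      linarith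
    · have := hsum.sum_le_tsum (Finset.range T) fun n _ => walkLaw_nonneg ε u n u
      rw [occupation]
      linarith
  have hD : ∀ T, dirichlet (occupation ε u T) ≤ 6 * G := fun T =>
    (dirichlet_occupation_le hε u T).trans (by linarith [hG T])
  have hlim : ∀ v, Tendsto (fun n => walkLaw ε u n v) atTop (nhds 0) := fun v => by
    obtain ⟨C, hC⟩ := exists_forall_le_of_dirichlet_le (occupation_hasFiniteSupport ε u) hD hG v
    exact (summable_of_sum_range_le (fun n => walkLaw_nonneg ε u n v) hC).tendsto_atTop_zero
  have hK : 0 < 1 + 2 * S := by linarith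
  -- This `t`, and the choice of `η` below, make each half of the sector bound at most `1`. The form
  -- exceeds `6 * (1 - 1 / 2) = 3` for a suitable `T`, contradicting the bound `2`.
  set t : ℝ := 1 / ((1 + 2 * S) * (6 * G)) with ht
  have ht0 : 0 < t := by positivity
  obtain ⟨h, hh, hu, hhD⟩ := exists_dirichlet_lt u (η := t / (1 + 2 * S)) (by positivity)
  have hlim2 : Tendsto (fun T => ∑' v, walkLaw ε u T v * h v) atTop (nhds 0) := by
    have e : ∀ T, ∑' v, walkLaw ε u T v * h v = ∑ v ∈ hh.toFinset, walkLaw ε u T v * h v :=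
      fun T => tsum_eq_sum fun v hv => by
        rw [notMem_support.1 fun h' => hv ((Set.Finite.mem_toFinset hh).2 h'), mul_zero]
    simp only [e]
    simpa using tendsto_finsetSum hh.toFinset fun v _ => (hlim v).mul_const (h v)
  obtain ⟨T, hT⟩ := (hlim2.eventually (gt_mem_nhds (by norm_num : (0 : ℝ) < 1 / 2))).exists
  have key := form_le_dirichlet_add hε hs hS (occupation_hasFiniteSupport ε u T) hh ht0
  rw [form_occupation ε u T hh, hu] at key
  have b1 : (1 + 2 * S) * (t * dirichlet (occupation ε u T)) ≤ 1 := by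
    calc _ ≤ (1 + 2 * S) * (t * (6 * G)) := by
          gcongr
          exact hD T
      _ = 1 := by
        rw [ht]
        field_simp
  have b2 : (1 + 2 * S) * (dirichlet h / t) ≤ 1 := by
    rw [← mul_div_assoc, div_le_one ht0]
    rw [lt_div_iff₀ hK] at hhD
    linarith
  rw [mul_add] at key
  linarith

lemma IsMarkovChain.measure_eq_walkLaw {ε : ℤ → ℤ} (hε : ∀ y, ε y = 1 ∨ ε y = -1)
    {Ω : Type*} [MeasurableSpace Ω] {μ : Measure Ω} [IsProbabilityMeasure μ] {u : ℤ × ℤ}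
    {M : ℕ → Ω → ℤ × ℤ} (hM : IsMarkovChain (transition ε) u μ M) (n : ℕ) (w : ℤ × ℤ) :
    μ {ω | M n ω = w} = ENNReal.ofReal (walkLaw ε u n w) := by
  induction n generalizing w with
  | zero =>
    by_cases h : w = u
    · rw [h, (mem_ae_iff_prob_eq_one (hM.measurableSet_eq 0 u)).1 hM.start]
      simp [walkLaw]
    · have : μ {ω | M 0 ω = w} = 0 := by
        have h0 : ∀ᵐ ω ∂μ, ω ∉ {ω | M 0 ω = w} := by
          filter_upwards [hM.start] with ω hω hw
          exact h (hw.symm.trans hω)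
        exact measure_eq_zero_iff_ae_notMem.2 h0
      rw [this]
      simp [walkLaw, h]
  | succ n ih =>
    have hne : ε w.2 ≠ 0 := by rcases hε w.2 with h | h <;> rw [h] <;> norm_num
    -- Only the three predecessors of `w` contribute; the horizontal one lies against the
    -- orientation of its row.
    have hsupp : ∀ v ∉ ({(w.1, w.2 + 1), (w.1, w.2 - 1), (w.1 - ε w.2, w.2)} : Finset (ℤ × ℤ)),
        μ {ω | M n ω = v} * ENNReal.ofReal (transition ε v w) = 0 := by
      rintro ⟨x, y⟩ hv
      have : ¬ AllowedEdge ε (x, y) w := by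
        contrapose! hv
        simp only [Finset.mem_insert, Finset.mem_singleton, Prod.ext_iff]
        rcases hv with ⟨h1, h2 | h2⟩ | ⟨h1, h2⟩
        · right; left; simp only at *; omega
        · left; simp only at *; omega
        · right; right
          simp only at *
          rw [h1]
          omega
      simp [transition, this]
    have t1 : transition ε (w.1, w.2 + 1) w = 1 / 3 := by
      rw [transition, if_pos]
      left
      simp
    have t2 : transition ε (w.1, w.2 - 1) w = 1 / 3 := by
      rw [transition, if_pos]
      left
      simp
    have t3 : transition ε (w.1 - ε w.2, w.2) w = 1 / 3 := by
      rw [transition, if_pos]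
      right
      simp
    have n1 := walkLaw_nonneg ε u n (w.1, w.2 + 1)
    have n2 := walkLaw_nonneg ε u n (w.1, w.2 - 1)
    have n3 := walkLaw_nonneg ε u n (w.1 - ε w.2, w.2)
    rw [hM.measure_succ, tsum_eq_sum hsupp, Finset.sum_insert, Finset.sum_insert,
      Finset.sum_singleton, t1, t2, t3, ih, ih, ih, ← ENNReal.ofReal_mul n1,
      ← ENNReal.ofReal_mul n2, ← ENNReal.ofReal_mul n3,
      ← ENNReal.ofReal_add (by positivity) (by positivity),
      ← ENNReal.ofReal_add (by positivity) (by positivity)]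
    · congr 1
      simp only [walkLaw, adjointStep]
      ring
    · simp [Prod.ext_iff]
    · simp only [Finset.mem_insert, Finset.mem_singleton, Prod.ext_iff]
      omega

/-- If the orientations are the increments of a bounded sequence, then the simple random walk is
recurrent. -/
theorem IsMarkovChain.frequently_eq_start {ε : ℤ → ℤ} (hε : ∀ y, ε y = 1 ∨ ε y = -1) {s : ℤ → ℝ}
    (hs : ∀ y, s (y + 1) = s y + ε y) {S : ℝ} (hS : ∀ y, |s y| ≤ S)
    {Ω : Type*} [MeasurableSpace Ω] {μ : Measure Ω} [IsProbabilityMeasure μ] {u : ℤ × ℤ}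
    {M : ℕ → Ω → ℤ × ℤ} (hM : IsMarkovChain (transition ε) u μ M) :
    ∀ᵐ ω ∂μ, ∃ᶠ n in atTop, M n ω = u := by
  refine hM.frequently_eq_of_tsum_eq_top ?_
  simp only [hM.measure_eq_walkLaw hε]
  by_contra h
  refine not_summable_walkLaw hε hs hS u ?_
  have := ENNReal.summable_toReal h
  simpa only [ENNReal.toReal_ofReal (walkLaw_nonneg ε u _ _)] using this

/-! ### Bounded primitives of the orientations -/

/-- A periodic integer sequence of zero mean is the sequence of increments of a bounded one. -/
lemma exists_bounded_of_periodic {Q : ℕ} (hQ : 0 < Q) {f : ℤ → ℤ}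
    (hf : Function.Periodic f (Q : ℤ)) (hsum : ∑ y ∈ Finset.Icc (1 : ℤ) (Q : ℤ), f y = 0) :
    ∃ (s : ℤ → ℝ) (S : ℝ), (∀ y, s (y + 1) = s y + f y) ∧ ∀ y, |s y| ≤ S := by
  have hQ' : (0 : ℤ) < Q := by exact_mod_cast hQ
  have hsum' : ∑ i ∈ Finset.range Q, f i = 0 := by
    have h1 : ∑ i ∈ Finset.range Q, f ((i : ℤ) + 1) = 0 := by
      rw [← hsum]
      refine Finset.sum_bij (fun i _ => (i : ℤ) + 1) ?_ ?_ ?_ ?_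
      · intro i hi
        rw [Finset.mem_range] at hi
        rw [Finset.mem_Icc]
        omega
      · intro i _ j _ h
        omega
      · intro b hb
        rw [Finset.mem_Icc] at hb
        exact ⟨(b - 1).toNat, by rw [Finset.mem_range]; omega, by omega⟩
      · intro i _
        rfl
    have h2 := Finset.sum_range_succ (fun i : ℕ => f i) Q
    have h3 := Finset.sum_range_succ' (fun i : ℕ => f i) Q
    have h4 : f Q = f 0 := by simpa using hf 0
    push_cast at h2 h3
    linarith
  -- Partial sums over the residue of `y`; the vanishing sum over a period makes them consistent
  -- when the residue wraps to `0`.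
  refine ⟨fun y => ((∑ i ∈ Finset.range (y % Q).toNat, f i : ℤ) : ℝ),
    ∑ k ∈ Finset.range Q, |((∑ i ∈ Finset.range k, f i : ℤ) : ℝ)|, fun y => ?_, fun y => ?_⟩
  · have hfy : f y = f (y % Q) := by
      conv_lhs => rw [← Int.emod_add_mul_ediv y Q, mul_comm (Q : ℤ)]
      simpa using (hf.int_mul (y / Q)) (y % Q)
    have h0 := Int.emod_nonneg y hQ'.ne'
    have h1 := Int.emod_lt_of_pos y hQ'
    beta_reduce
    rw [← Int.cast_add]
    congr 1
    rw [hfy]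
    obtain ⟨r, hr⟩ := Int.eq_ofNat_of_zero_le h0
    have hadd : (y + 1) % Q = (r + 1) % Q := by rw [← Int.emod_add_emod, hr]
    rw [hr] at h1
    rw [hadd, hr]
    rcases eq_or_ne (r + 1) Q with h | h
    · have e : ((r : ℤ) + 1) % Q = 0 := by
        rw [show (r : ℤ) + 1 = Q by exact_mod_cast h, Int.emod_self]
      rw [e]
      simp only [Int.toNat_zero, Finset.range_zero, Finset.sum_empty, Int.toNat_natCast]
      rw [← Finset.sum_range_succ (fun i : ℕ => f i), h, hsum']
    · rw [Int.emod_eq_of_lt (by omega) (by omega)]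
      rw [show ((r : ℤ) + 1).toNat = r + 1 by omega, Int.toNat_natCast]
      exact Finset.sum_range_succ (fun i : ℕ => f i) r
  · have h0 := Int.emod_nonneg y hQ'.ne'
    have h1 := Int.emod_lt_of_pos y hQ'
    exact Finset.single_le_sum (f := fun k : ℕ => |((∑ i ∈ Finset.range k, f i : ℤ) : ℝ)|)
      (fun k _ => abs_nonneg _) (Finset.mem_range.2 (by omega : (y % Q).toNat < Q))

/-- A finitely supported sequence is the sequence of increments of a bounded one. -/
lemma exists_bounded_of_finite {d : ℤ → ℤ} (hd : d.HasFiniteSupport) :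
    ∃ (s : ℤ → ℝ) (S : ℝ), (∀ y, s (y + 1) = s y + d y) ∧ ∀ y, |s y| ≤ S := by
  refine ⟨fun y => ∑ z ∈ hd.toFinset, if z < y then (d z : ℝ) else 0,
    ∑ z ∈ hd.toFinset, |(d z : ℝ)|, fun y => ?_, fun y => ?_⟩
  · have h1 : (d y : ℝ) = ∑ z ∈ hd.toFinset, if z = y then (d z : ℝ) else 0 := by
      rw [Finset.sum_ite_eq']
      split_ifs with h
      · rfl
      · rw [notMem_support.1 fun h' => h ((Set.Finite.mem_toFinset hd).2 h'), Int.cast_zero]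
    rw [h1, ← Finset.sum_add_distrib]
    refine Finset.sum_congr rfl fun z _ => ?_
    rcases lt_trichotomy z y with h | h | h
    · simp [h, h.ne, h.trans (lt_add_one y)]
    · simp [h]
    · simp [h.not_gt, h.ne', not_lt.2 (show y + 1 ≤ z from h)]
  · refine (Finset.abs_sum_le_sum_abs _ _).trans (Finset.sum_le_sum fun z _ => ?_)
    split_ifs
    · exact le_rfl
    · simp

end PartiallyDirectedLattice

/-- If the deterministic defect sequence `lam` has finitely many ones, then, for every realisation
of the signs `ρ`, the simple random walk is recurrent: started at any vertex `u`, it almost surely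
returns to `u` infinitely often. -/
theorem proposition1p3
    (Q : ℕ) (hQ : 2 ≤ Q) (hQ_even : Even Q)
    (f : ℤ → ℤ) (hf : ∀ y, f y = 1 ∨ f y = -1)
    (hf_periodic : Function.Periodic f (Q : ℤ))
    (hf_centred : ∑ y ∈ Finset.Icc (1 : ℤ) (Q : ℤ), f y = 0)
    (ρ : ℤ → ℤ) (hρ : ∀ y, ρ y = 1 ∨ ρ y = -1)
    (lam : ℤ → ℤ) (hlam : ∀ y, lam y = 0 ∨ lam y = 1)
    (hlam_finite : {y : ℤ | lam y = 1}.Finite)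
    {Ω : Type*} [MeasurableSpace Ω] (μ : Measure Ω) [IsProbabilityMeasure μ]
    (u : ℤ × ℤ) (M : ℕ → Ω → ℤ × ℤ)
    (hM : PartiallyDirectedLattice.IsMarkovChain
      (PartiallyDirectedLattice.transition
        (PartiallyDirectedLattice.orientation f lam ρ)) u μ M) :
    ∀ᵐ ω ∂μ, ∃ᶠ n in atTop, M n ω = u := by
  obtain ⟨s₁, S₁, hs₁, hS₁⟩ :=
    PartiallyDirectedLattice.exists_bounded_of_periodic (by omega) hf_periodic hf_centred
  -- This is the deviation of the orientations from `f`; the two bounded primitives add up.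
  have hd : (fun y => lam y * (ρ y - f y)).HasFiniteSupport := hlam_finite.subset fun y hy => by
    rcases hlam y with h | h
    · exact absurd (by simp [h]) hy
    · exact h
  obtain ⟨s₂, S₂, hs₂, hS₂⟩ := PartiallyDirectedLattice.exists_bounded_of_finite hd
  refine hM.frequently_eq_start (s := fun y => s₁ y + s₂ y) (S := S₁ + S₂) (fun y => ?_)
    (fun y => ?_) (fun y => (abs_add_le _ _).trans (add_le_add (hS₁ y) (hS₂ y)))
  · rcases hlam y with h | h <;> simp [PartiallyDirectedLattice.orientation, h, hf, hρ]
  · rw [hs₁, hs₂, PartiallyDirectedLattice.orientation]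
    push_cast
    ring
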